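/- Let the Rudin--Shapiro polynomials be defined by $P_0(z)=Q_0(z)=1$ and, for $t\ge 0$, $P_{t+1}(z)=P_t(z)+z^{2^t}Q_t(z)$, $Q_{t+1}(z)=P_t(z)-z^{2^t}Q_t(z)$. The first $2^t$ terms of $P_{t+1}$ are those of $P_t$, so there is a unique sequence $(a_i)_{i\ge 0}$ such that $P_t(z)=\sum_{i=0}^{2^t-1}a_iz^i$ for all $t\ge 0$. For $n\ge m\ge 0$ write $P_{<n}(z)=\sum_{i=0}^{n-1}a_iz^i$ and $P_{[m,n)}(z)=P_{<n}(z)-P_{<m}(z)=\sum_{i=m}^{n-1}a_iz^i$. Theorem. For all integers $n\ge m\ge 0$ and all $z\in\mathbb{C}$ with $|z|=1$, $$|P_{[m,n)}(z)|\le\sqrt{10(n-m)}.$$ -/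

import Mathlib

open Polynomial

/-- The pair `(P_t, Q_t)` of Rudin–Shapiro polynomials: `P_0 = Q_0 = 1`,
`P_{t+1} = P_t + z^(2^t) Q_t` and `Q_{t+1} = P_t - z^(2^t) Q_t`. -/
noncomputable def rudinShapiroPair : ℕ → ℂ[X] × ℂ[X]
  | 0 => (1, 1)
  | t + 1 =>
    ((rudinShapiroPair t).1 + X ^ (2 ^ t) * (rudinShapiroPair t).2,
      (rudinShapiroPair t).1 - X ^ (2 ^ t) * (rudinShapiroPair t).2)

/-- The Rudin–Shapiro polynomial `P_t`. -/
noncomputable def rudinShapiroP (t : ℕ) : ℂ[X] := (rudinShapiroPair t).1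

/-- The Rudin–Shapiro polynomial `Q_t`. -/
noncomputable def rudinShapiroQ (t : ℕ) : ℂ[X] := (rudinShapiroPair t).2

/-- The coefficient `a_n` of the power series `P_∞`, whose first `2 ^ t` terms are those of `P_t`
for every `t`. As `n < 2 ^ n`, it can be read off from `P_n`; every `t` with `n < 2 ^ t` gives the
same value, see `rudinShapiroCoeff_eq`. -/
noncomputable def rudinShapiroCoeff (n : ℕ) : ℂ := (rudinShapiroP n).coeff n

/-- `P_{<n} = ∑_{i<n} a_i z^i`, the first `n` terms of `P_∞`. -/
noncomputable def rudinShapiroLT (n : ℕ) : ℂ[X] :=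
  ∑ i ∈ Finset.range n, C (rudinShapiroCoeff i) * X ^ i

/-- `P_{[m,n)} = P_{<n} - P_{<m}`; for `m ≤ n` it is `∑_{m≤i<n} a_i z^i`,
see `eval_rudinShapiroIco`. -/
noncomputable def rudinShapiroIco (m n : ℕ) : ℂ[X] := rudinShapiroLT n - rudinShapiroLT m

theorem rudinShapiroP_succ (t : ℕ) :
    rudinShapiroP (t + 1) = rudinShapiroP t + X ^ (2 ^ t) * rudinShapiroQ t := rfl

theorem rudinShapiroQ_succ (t : ℕ) :
    rudinShapiroQ (t + 1) = rudinShapiroP t - X ^ (2 ^ t) * rudinShapiroQ t := rfl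

theorem rudinShapiroP_coeff_add {n t : ℕ} (h : n < 2 ^ t) (k : ℕ) :
    (rudinShapiroP (t + k)).coeff n = (rudinShapiroP t).coeff n := by
  induction k with
  | zero => rfl
  | succ k ih =>
    have h2 : n < 2 ^ (t + k) := h.trans_le (Nat.pow_le_pow_right (by norm_num) (by omega))
    rw [← add_assoc, rudinShapiroP_succ, coeff_add, ih, coeff_X_pow_mul', if_neg (by omega),
      add_zero]

/-- `a_n` is the coefficient of `z^n` in every `P_t` with `n < 2 ^ t`. -/
theorem rudinShapiroCoeff_eq {n t : ℕ} (h : n < 2 ^ t) :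
    rudinShapiroCoeff n = (rudinShapiroP t).coeff n := by
  unfold rudinShapiroCoeff
  rcases le_total n t with hnt | hnt
  · obtain ⟨k, rfl⟩ := Nat.exists_eq_add_of_le hnt
    exact (rudinShapiroP_coeff_add Nat.lt_two_pow_self k).symm
  · obtain ⟨k, rfl⟩ := Nat.exists_eq_add_of_le hnt
    exact rudinShapiroP_coeff_add h k

/-- `P_{[m,n)}(z) = ∑_{m≤i<n} a_i z^i`. -/
theorem eval_rudinShapiroIco {m n : ℕ} (h : m ≤ n) (z : ℂ) :
    (rudinShapiroIco m n).eval z = ∑ i ∈ Finset.Ico m n, rudinShapiroCoeff i * z ^ i := by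
  rw [Finset.sum_Ico_eq_sub _ h]
  simp [rudinShapiroIco, rudinShapiroLT, eval_finsetSum]

/-! Halving a block repeatedly reduces any segment to a final segment of a left half followed by an
initial segment of a right half, so everything rests on `Bounded`. Since `Bounded` adds norms,
unimodular factors on the two pieces do not matter. It is proved in `bounded` by strong induction on
the level, for all systems at once, because some cases are read backwards through `swap`.

After some splittings the sum is a combination of the two full blocks of one level, with
coefficients `α`, `β`, plus one initial and one final partial block. By the parallelogram law the
full blocks satisfy `energy`, so Cauchy–Schwarz controls the combination through `‖α‖ ^ 2 + ‖β‖ ^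
2`. The partial blocks can be treated by induction as they stand (`Bounded.inner`, effective when `x
+ y` is small), or completed to full blocks, subtracting complements that are again one final and
one initial segment (`Bounded.outer`, effective when `x + y` is close to `2 * 2 ^ t`).

If the two ranges leave a gap, the partial blocks are split once more: `bound_one` leads to
`bound_three` and `bound_four`, and `bound_three` to `bound_seven`. What remains is to bound `‖α‖ ^
2 + ‖β‖ ^ 2` uniformly in the unimodular parameters. -/

/-! ### Block systems and their reversal -/

/-- A binary tree of blocks with the Rudin–Shapiro splitting rule, up to unimodular factors.
At level `t` there are the two blocks `v false t` and `v true t`, of length `2 ^ t`;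
`R b t x` is the sum over the first `x` terms of the block `b`,
and `L b t y` is the sum over its last `y` terms. -/
structure GolaySystem where
  v : Bool → ℕ → ℂ
  R : Bool → ℕ → ℕ → ℂ
  L : Bool → ℕ → ℕ → ℂ
  w : ℕ → ℂ
  c : ℕ → ℂ
  d : ℕ → ℂ
  norm_w : ∀ t, ‖w t‖ = 1
  norm_c : ∀ t, ‖c t‖ = 1
  norm_d : ∀ t, ‖d t‖ = 1
  norm_v_zero : ∀ b, ‖v b 0‖ = 1
  v_false_succ : ∀ t, v false (t + 1) = c t * (v false t + w t * v true t)
  v_true_succ : ∀ t, v true (t + 1) = d t * (v false t - w t * v true t)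
  R_false_low : ∀ t x, x ≤ 2 ^ t → R false (t + 1) x = c t * R false t x
  R_true_low : ∀ t x, x ≤ 2 ^ t → R true (t + 1) x = d t * R false t x
  R_false_high : ∀ t x, x ≤ 2 ^ t →
    R false (t + 1) (2 ^ t + x) = c t * (v false t + w t * R true t x)
  R_true_high : ∀ t x, x ≤ 2 ^ t →
    R true (t + 1) (2 ^ t + x) = d t * (v false t - w t * R true t x)
  L_false_low : ∀ t y, y ≤ 2 ^ t → L false (t + 1) y = c t * (w t * L true t y)
  L_true_low : ∀ t y, y ≤ 2 ^ t → L true (t + 1) y = -(d t * (w t * L true t y))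
  L_false_high : ∀ t y, y ≤ 2 ^ t →
    L false (t + 1) (2 ^ t + y) = c t * (w t * v true t + L false t y)
  L_true_high : ∀ t y, y ≤ 2 ^ t →
    L true (t + 1) (2 ^ t + y) = d t * (-(w t * v true t) + L false t y)
  R_add_L : ∀ b t x y, x + y = 2 ^ t → R b t x + L b t y = v b t
  norm_R_le : ∀ b t x, x ≤ 2 ^ t → ‖R b t x‖ ≤ x
  norm_L_le : ∀ b t y, y ≤ 2 ^ t → ‖L b t y‖ ≤ y

namespace GolaySystem

variable (S : GolaySystem)

theorem w_mul_inv (t : ℕ) : S.w t * (S.w t)⁻¹ = 1 :=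
  mul_inv_cancel₀ (norm_ne_zero_iff.1 (by rw [S.norm_w]; norm_num))

/-- Reading the tree backwards. -/
noncomputable def swap : GolaySystem where
  v b := S.v (!b)
  R b := S.L (!b)
  L b := S.R (!b)
  -- Reversal exchanges the two types: `v false - w * v true = -w * (v true - w⁻¹ * v false)`. The
  -- unimodular factors `c` and `d` are in the structure to absorb the `w` pulled out here.
  w t := -(S.w t)⁻¹
  c t := -(S.d t * S.w t)
  d t := S.c t * S.w t
  norm_w t := by simp [S.norm_w]
  norm_c t := by simp [S.norm_w, S.norm_d]
  norm_d t := by simp [S.norm_w, S.norm_c]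
  norm_v_zero b := S.norm_v_zero _
  v_false_succ t := by
    simp only [Bool.not_false, Bool.not_true, S.v_true_succ]
    linear_combination (-S.d t * S.v false t) * S.w_mul_inv t
  v_true_succ t := by
    simp only [Bool.not_false, Bool.not_true, S.v_false_succ]
    linear_combination (-S.c t * S.v false t) * S.w_mul_inv t
  R_false_low t x h := by
    simp only [Bool.not_false, S.L_true_low t x h]; ring
  R_true_low t x h := by
    simp only [Bool.not_false, Bool.not_true, S.L_false_low t x h]; ring
  R_false_high t x h := by
    simp only [Bool.not_false, Bool.not_true, S.L_true_high t x h]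
    linear_combination (-S.d t * S.L false t x) * S.w_mul_inv t
  R_true_high t x h := by
    simp only [Bool.not_false, Bool.not_true, S.L_false_high t x h]
    linear_combination (-S.c t * S.L false t x) * S.w_mul_inv t
  L_false_low t y h := by
    simp only [Bool.not_false, Bool.not_true, S.R_true_low t y h]
    linear_combination (-S.d t * S.R false t y) * S.w_mul_inv t
  L_true_low t y h := by
    simp only [Bool.not_true, S.R_false_low t y h]
    linear_combination (-S.c t * S.R false t y) * S.w_mul_inv t
  L_false_high t y h := by
    simp only [Bool.not_false, Bool.not_true, S.R_true_high t y h]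
    linear_combination (-S.d t * S.v false t) * S.w_mul_inv t
  L_true_high t y h := by
    simp only [Bool.not_false, Bool.not_true, S.R_false_high t y h]
    linear_combination (-S.c t * S.v false t) * S.w_mul_inv t
  R_add_L b t x y h := by rw [add_comm]; exact S.R_add_L _ t y x (by omega)
  norm_R_le b := S.norm_L_le _
  norm_L_le b := S.norm_R_le _

/-! ### Energy of full blocks; the inner and outer bounds -/

theorem parallelogram (a b : ℂ) : ‖a + b‖ ^ 2 + ‖a - b‖ ^ 2 = 2 * (‖a‖ ^ 2 + ‖b‖ ^ 2) := by
  have := parallelogram_law_with_norm ℝ a b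
  linarith

theorem energy (t : ℕ) : ‖S.v false t‖ ^ 2 + ‖S.v true t‖ ^ 2 = 2 * 2 ^ t := by
  induction t with
  | zero => simp [S.norm_v_zero]; norm_num
  | succ t ih =>
    rw [S.v_false_succ, S.v_true_succ, norm_mul, norm_mul, S.norm_c, S.norm_d, one_mul, one_mul,
      parallelogram, norm_mul, S.norm_w, one_mul, ih]
    ring

/-- Cauchy–Schwarz against `energy`; only the squared length of the coefficient vector matters. -/
theorem norm_combination_le (t : ℕ) (α β : ℂ) {n : ℝ} (hn : ‖α‖ ^ 2 + ‖β‖ ^ 2 ≤ n) :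
    ‖α * S.v false t + β * S.v true t‖ ≤ √(2 * n * 2 ^ t) := by
  apply Real.le_sqrt_of_sq_le
  have h1 : ‖α * S.v false t + β * S.v true t‖ ≤
      ‖α‖ * ‖S.v false t‖ + ‖β‖ * ‖S.v true t‖ := by
    simpa only [norm_mul] using norm_add_le (α * S.v false t) (β * S.v true t)
  have h2 := S.energy t
  have h3 : (0 : ℝ) < 2 ^ t := by positivity
  calc ‖α * S.v false t + β * S.v true t‖ ^ 2
      ≤ (‖α‖ * ‖S.v false t‖ + ‖β‖ * ‖S.v true t‖) ^ 2 := by gcongr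
    _ ≤ (‖α‖ ^ 2 + ‖β‖ ^ 2) * (‖S.v false t‖ ^ 2 + ‖S.v true t‖ ^ 2) := by
        nlinarith [sq_nonneg (‖α‖ * ‖S.v true t‖ - ‖β‖ * ‖S.v false t‖)]
    _ ≤ n * (2 * 2 ^ t) := by rw [h2]; gcongr
    _ = 2 * n * 2 ^ t := by ring

/-- The bound for an initial segment of a block together with a final segment of a block. -/
def Bounded (t : ℕ) : Prop :=
  ∀ a b x y, x ≤ 2 ^ t → y ≤ 2 ^ t → ‖S.R a t x‖ + ‖S.L b t y‖ ≤ √(10 * ((x : ℝ) + y))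

theorem sq_sqrt_add_sqrt_le {a b s : ℝ} (ha : 0 ≤ a) (hb : 0 ≤ b) (hs : a + b ≤ s)
    (h : 4 * (a * b) ≤ (s - a - b) ^ 2) : (√a + √b) ^ 2 ≤ s := by
  have h1 := Real.sq_sqrt ha
  have h2 := Real.sq_sqrt hb
  have h3 : 2 * (√a * √b) ≤ s - a - b := by
    apply le_of_sq_le_sq _ (by linarith)
    calc (2 * (√a * √b)) ^ 2 = 4 * (√a ^ 2 * √b ^ 2) := by ring
      _ ≤ _ := by rw [h1, h2]; exact h
  nlinarith

variable {S}

/-- A bound by the full blocks inside. -/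
theorem Bounded.inner {t : ℕ} (hB : S.Bounded t) {a b : Bool} {x y : ℕ} (hx : x ≤ 2 ^ t)
    (hy : y ≤ 2 ^ t) {α β ρ l : ℂ} (hρ : ‖ρ‖ = 1) (hl : ‖l‖ = 1) {n M : ℝ}
    (hn : ‖α‖ ^ 2 + ‖β‖ ^ 2 ≤ n) (hM : n ≤ 5 * M)
    (h : 20 * n * ((x : ℝ) + y) ≤ (5 * M - n) ^ 2 * 2 ^ t) :
    ‖α * S.v false t + β * S.v true t + ρ * S.R a t x + l * S.L b t y‖ ^ 2 ≤
      10 * (M * 2 ^ t + x + y) := by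
  have hn0 : 0 ≤ n := le_trans (by positivity) hn
  have h3 : (0 : ℝ) < 2 ^ t := by positivity
  have h1 := S.norm_combination_le t α β hn
  have h2 := hB a b x y hx hy
  have h4 : ‖α * S.v false t + β * S.v true t + ρ * S.R a t x + l * S.L b t y‖ ≤
      √(2 * n * 2 ^ t) + √(10 * ((x : ℝ) + y)) := by
    refine (norm_add_le _ _).trans ?_
    have := norm_add_le (α * S.v false t + β * S.v true t) (ρ * S.R a t x)
    rw [norm_mul, hρ] at this
    rw [norm_mul, hl]
    linarith
  -- The cross term `2 * √(2 * n * 2 ^ t) * √(10 * (x + y))` must fit into `(10 * M - 2 * n) * 2 ^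
  -- t`; squared, this is `h`.
  refine (pow_le_pow_left₀ (norm_nonneg _) h4 2).trans
    (sq_sqrt_add_sqrt_le (by positivity) (by positivity) ?_ ?_)
  · nlinarith
  · nlinarith

/-- A bound by the full blocks met. -/
theorem Bounded.outer {t : ℕ} (hB : S.Bounded t) {a b : Bool} {x y : ℕ} (hx : x ≤ 2 ^ t)
    (hy : y ≤ 2 ^ t) {α β ρ l : ℂ} (hρ : ‖ρ‖ = 1) (hl : ‖l‖ = 1) (α' β' : ℂ) (n s : ℝ) {M : ℝ}
    (hfull : α * S.v false t + β * S.v true t + ρ * S.v a t + l * S.v b t =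
      α' * S.v false t + β' * S.v true t)
    (hn : ‖α'‖ ^ 2 + ‖β'‖ ^ 2 ≤ n) (hs : 2 * 2 ^ t - ((x : ℝ) + y) ≤ s * 2 ^ t)
    (hM : n + 10 * s ≤ 5 * (M + 2))
    (h : 20 * n * s ≤ (5 * (M + 2) - n - 10 * s) ^ 2) :
    ‖α * S.v false t + β * S.v true t + ρ * S.R a t x + l * S.L b t y‖ ^ 2 ≤
      10 * (M * 2 ^ t + x + y) := by
  have hn0 : 0 ≤ n := le_trans (by positivity) hn
  have h3 : (0 : ℝ) < 2 ^ t := by positivity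
  obtain ⟨x', hx'⟩ := Nat.exists_eq_add_of_le hx
  obtain ⟨y', hy'⟩ := Nat.exists_eq_add_of_le hy
  have hxr : (2 : ℝ) ^ t = x + x' := by exact_mod_cast hx'
  have hyr : (2 : ℝ) ^ t = y + y' := by exact_mod_cast hy'
  have e1 := S.R_add_L a t x x' hx'.symm
  have e2 := S.R_add_L b t y' y (by omega)
  have h1 := S.norm_combination_le t α' β' hn
  -- The complement of the initial piece of `a` is a final piece, and conversely, so the induction
  -- hypothesis applies with the types exchanged.
  have h2 := hB b a y' x' (by omega) (by omega)
  have e3 : α * S.v false t + β * S.v true t + ρ * S.R a t x + l * S.L b t y =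
      (α' * S.v false t + β' * S.v true t) - ρ * S.L a t x' - l * S.R b t y' := by
    rw [← hfull]; linear_combination ρ * e1 + l * e2
  have h4 : ‖α * S.v false t + β * S.v true t + ρ * S.R a t x + l * S.L b t y‖ ≤
      √(2 * n * 2 ^ t) + √(10 * ((y' : ℝ) + x')) := by
    rw [e3]
    refine (norm_sub_le _ _).trans ?_
    have := norm_sub_le (α' * S.v false t + β' * S.v true t) (ρ * S.L a t x')
    rw [norm_mul, hρ] at this
    rw [norm_mul, hl]
    linarith
  have h5 : (y' : ℝ) + x' ≤ s * 2 ^ t := by linarith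
  have h6 : (0 : ℝ) ≤ (y' : ℝ) + x' := by positivity
  have h7 : 10 * (M * 2 ^ t + x + y) = 10 * (M + 2) * 2 ^ t - 10 * ((y' : ℝ) + x') := by linarith
  have h8 : √(10 * ((y' : ℝ) + x')) ≤ √(10 * (s * 2 ^ t)) := Real.sqrt_le_sqrt (by linarith)
  have hs0 : 0 ≤ s := by
    by_contra hneg
    nlinarith
  -- The complement may be replaced by its upper bound `s * 2 ^ t`: the left side increases with it
  -- and the right side decreases.
  have h9 : (√(2 * n * 2 ^ t) + √(10 * (s * 2 ^ t))) ^ 2 ≤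
      10 * (M + 2) * 2 ^ t - 10 * (s * 2 ^ t) := by
    refine sq_sqrt_add_sqrt_le (by positivity) (by positivity) ?_ ?_
    · nlinarith
    · have : (0 : ℝ) < (2 ^ t) ^ 2 := by positivity
      nlinarith
  rw [h7]
  refine (pow_le_pow_left₀ (norm_nonneg _) (h4.trans (add_le_add_right h8 _)) 2).trans ?_
  linarith

/-! ### Coefficient estimates with unimodular parameters -/

theorem sq_norm_add (a b : ℂ) :
    ‖a + b‖ ^ 2 = ‖a‖ ^ 2 + ‖b‖ ^ 2 + 2 * (a * (starRingEnd ℂ) b).re := by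
  simp only [Complex.sq_norm, Complex.normSq_add]

theorem sq_norm_add_le {a u : ℂ} (hu : ‖u‖ = 1) : ‖a + u‖ ^ 2 ≤ ‖a‖ ^ 2 + 1 + 2 * ‖a‖ := by
  have := norm_add_le a u
  rw [hu] at this
  nlinarith [norm_nonneg (a + u), norm_nonneg a]

/-- The parallelogram law after a splitting in which each coordinate gains a unimodular term; the
weight `k` balances `2 * r ≤ r ^ 2 / k + k`. -/
theorem sq_norm_add_add_sq_norm_sub_add_le (a b : ℂ) {e f : ℂ} (he : ‖e‖ = 1) (hf : ‖f‖ = 1)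
    {k : ℝ} (hk : 0 < k) :
    ‖a + b + e‖ ^ 2 + ‖a - b + f‖ ^ 2 ≤
      2 * (1 + 1 / k) * (‖a‖ ^ 2 + ‖b‖ ^ 2) + 2 + 2 * k := by
  have h1 := sq_norm_add_le (a := a + b) he
  have h2 := sq_norm_add_le (a := a - b) hf
  have h3 := parallelogram a b
  have h4 : ∀ r : ℝ, 2 * r ≤ r ^ 2 / k + k := fun r => by
    rw [div_add' _ _ _ hk.ne', le_div_iff₀ hk]
    nlinarith [sq_nonneg (r - k)]
  have h5 := h4 ‖a + b‖
  have h6 := h4 ‖a - b‖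
  have h7 : ‖a + b‖ ^ 2 / k + ‖a - b‖ ^ 2 / k = 2 * (1 / k) * (‖a‖ ^ 2 + ‖b‖ ^ 2) := by
    rw [← add_div, h3]; ring
  nlinarith

theorem norm_one_add_le {ρ : ℂ} (hρ : ‖ρ‖ = 1) : ‖1 + ρ‖ ≤ 2 := by
  have := norm_add_le 1 ρ
  rw [norm_one, hρ] at this
  linarith

theorem sq_norm_one_add {ρ : ℂ} (hρ : ‖ρ‖ = 1) : ‖1 + ρ‖ ^ 2 = 2 + 2 * ρ.re := by
  have h1 : ‖ρ‖ ^ 2 = 1 := by rw [hρ]; norm_num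
  simp only [Complex.sq_norm, Complex.normSq_apply] at *
  simp; linarith

theorem norm_one_add_sub_le {ρ v : ℂ} (hv : ‖v‖ = 1) : ‖1 + ρ - v‖ ≤ ‖1 + ρ‖ + 1 := by
  have := norm_sub_le (1 + ρ) v
  rwa [hv] at this

section coordinates

variable {ρ v μ : ℂ}

theorem abs_re_mul_one_add_le (hv : ‖v‖ = 1) :
    |v.re + (ρ * v).re| ≤ ‖1 + ρ‖ := by
  have h := Complex.abs_re_le_norm (v * (1 + ρ))
  rw [norm_mul, hv, one_mul] at h
  convert h using 2
  simp; ring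

/-- The cross terms collapse to the real part of `v * (1 + ρ)`, which is at most `‖1 + ρ‖` in size.
Keeping `‖1 + ρ‖` as a variable is needed in `sq_norm_right_outer_le`. -/
theorem sq_norm_digit (hρ : ‖ρ‖ = 1) (hv : ‖v‖ = 1) :
    ‖1 + ρ + v - ρ * v‖ ^ 2 + ‖1 + ρ - v‖ ^ 2 ≤ 5 + ‖1 + ρ‖ ^ 2 + 2 * ‖1 + ρ‖ := by
  have h0 := abs_le.1 (abs_re_mul_one_add_le (ρ := ρ) hv)
  rw [sq_norm_one_add hρ]
  have h1 : ‖ρ‖ ^ 2 = 1 := by rw [hρ]; norm_num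
  have h2 : ‖v‖ ^ 2 = 1 := by rw [hv]; norm_num
  have key : ‖1 + ρ + v - ρ * v‖ ^ 2 + ‖1 + ρ - v‖ ^ 2 =
      7 + 2 * ρ.re - 2 * (v.re + (ρ * v).re) := by
    simp only [Complex.sq_norm, Complex.normSq_apply] at *
    simp at *
    grind
  linarith [h0.1]

theorem sq_norm_digit_le (hρ : ‖ρ‖ = 1) (hv : ‖v‖ = 1) :
    ‖1 + ρ + v - ρ * v‖ ^ 2 + ‖1 + ρ - v‖ ^ 2 ≤ 13 := by
  have := sq_norm_digit hρ hv
  nlinarith [norm_one_add_le hρ, norm_nonneg (1 + ρ)]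

theorem sq_norm_two_digits_le (hρ : ‖ρ‖ = 1) (hv : ‖v‖ = 1) (hμ : ‖μ‖ = 1) :
    ‖1 + ρ + v - ρ * v‖ ^ 2 + ‖1 + ρ - v + μ‖ ^ 2 ≤ 20 := by
  have := sq_norm_digit_le hρ hv
  have := sq_norm_add_le (a := 1 + ρ - v) hμ
  have := norm_one_add_sub_le (ρ := ρ) hv
  linarith [norm_one_add_le hρ]

theorem sq_norm_left_digit_le (hρ : ‖ρ‖ = 1) (hv : ‖v‖ = 1) (hμ : ‖μ‖ = 1) :
    ‖1 + ρ + v‖ ^ 2 + ‖1 + ρ - v + μ‖ ^ 2 ≤ 17 := by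
  have h1 := parallelogram (1 + ρ) v
  have := sq_norm_add_le (a := 1 + ρ - v) hμ
  have := norm_one_add_sub_le (ρ := ρ) hv
  rw [hv] at h1
  nlinarith [norm_one_add_le hρ, norm_nonneg (1 + ρ)]

theorem re_mul_conj_le (a b : ℂ) : (a * (starRingEnd ℂ) b).re ≤ ‖a‖ * ‖b‖ := by
  simpa using Complex.re_le_norm (a * (starRingEnd ℂ) b)

/-- The terms `-μ` and `μ` are treated jointly: their cross terms combine to `v * (ρ - 2)` against
`μ`, of size at most 3, so the bound is `13 + 2 + 2 * 3`. -/
theorem sq_norm_left_digit_outer_le (hρ : ‖ρ‖ = 1) (hv : ‖v‖ = 1) (hμ : ‖μ‖ = 1) :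
    ‖1 + ρ + v - ρ * v - μ‖ ^ 2 + ‖1 + ρ - v + μ‖ ^ 2 ≤ 21 := by
  have h0 := sq_norm_digit_le hρ hv
  rw [sub_eq_add_neg (1 + ρ + v - ρ * v) μ, sq_norm_add, sq_norm_add (1 + ρ - v), norm_neg, hμ]
  have h1 := re_mul_conj_le (v * (ρ - 2)) μ
  have h2 : ‖v * (ρ - 2)‖ ≤ 3 := by
    rw [norm_mul, hv, one_mul]
    have := norm_sub_le ρ 2
    rw [hρ] at this
    norm_num at this
    exact this
  have h3 : ((1 + ρ - v) * (starRingEnd ℂ) μ).re +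
      ((1 + ρ + v - ρ * v) * (starRingEnd ℂ) (-μ)).re =
      (v * (ρ - 2) * (starRingEnd ℂ) μ).re := by
    rw [← Complex.add_re]; congr 1; rw [map_neg]; ring
  rw [hμ] at h1
  linarith

/-- Expansion of the squared norm after a splitting in which the second half gets a term. -/
theorem sq_norm_split_le (a b e : ℂ) (he : ‖e‖ = 1) :
    ‖a + b‖ ^ 2 + ‖a - b + e‖ ^ 2 ≤
      2 * ‖a‖ ^ 2 + 2 * ‖b‖ ^ 2 + 1 + 2 * ‖b‖ + 2 * (a * (starRingEnd ℂ) e).re := by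
  have h1 := parallelogram a b
  rw [sq_norm_add (a - b) e, he]
  have h2 := re_mul_conj_le (-b) e
  rw [norm_neg, he] at h2
  have h3 : ((a - b) * (starRingEnd ℂ) e).re =
      (a * (starRingEnd ℂ) e).re + (-b * (starRingEnd ℂ) e).re := by
    rw [← Complex.add_re]; congr 1; ring
  linarith

theorem sq_norm_right_outer_le (hρ : ‖ρ‖ = 1) (hv : ‖v‖ = 1) (hμ : ‖μ‖ = 1) {b : ℂ}
    (hb : ‖b‖ = ‖1 + ρ - v + μ‖) :
    ‖1 + ρ + v - ρ * v + b‖ ^ 2 + ‖1 + ρ + v - ρ * v - b - μ‖ ^ 2 ≤ 45 := by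
  have h0 := sq_norm_split_le (1 + ρ + v - ρ * v) b (-μ) (by rw [norm_neg, hμ])
  rw [← sub_eq_add_neg, hb] at h0
  have h1 := sq_norm_digit hρ hv
  have hs2 := norm_one_add_le hρ
  have hs0 := norm_nonneg (1 + ρ)
  have h2 := norm_one_add_sub_le (ρ := ρ) hv
  have h3 : ‖1 + ρ - v + μ‖ ≤ ‖1 + ρ - v‖ + 1 := by
    have := norm_add_le (1 + ρ - v) μ
    rwa [hμ] at this
  have h4 : 2 * ‖1 + ρ - v + μ‖ ^ 2 +
      2 * ((1 + ρ + v - ρ * v) * (starRingEnd ℂ) (-μ)).re =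
      2 * ‖1 + ρ - v‖ ^ 2 + 2 + 2 * ((1 + ρ + v * (ρ - 3)) * (starRingEnd ℂ) μ).re := by
    have e : ((1 + ρ + v * (ρ - 3)) * (starRingEnd ℂ) μ).re =
        2 * ((1 + ρ - v) * (starRingEnd ℂ) μ).re +
          ((1 + ρ + v - ρ * v) * (starRingEnd ℂ) (-μ)).re := by
      simp; ring
    rw [e, sq_norm_add (1 + ρ - v) μ, hμ]; ring
  have h5 := re_mul_conj_le (1 + ρ + v * (ρ - 3)) μ
  rw [hμ, mul_one] at h5
  have h6 := norm_add_le (1 + ρ) (v * (ρ - 3))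
  rw [norm_mul, hv, one_mul] at h6
  -- With `s = ‖1 + ρ‖` the left side is `√(16 - 3 * s ^ 2)`, concave in `s`; the right side is its
  -- tangent at `s = 2`, where the final bound 45 is reached.
  have h7 : ‖ρ - 3‖ ≤ 8 - 3 * ‖1 + ρ‖ := by
    apply le_of_sq_le_sq _ (by linarith)
    have e1 := sq_norm_one_add hρ
    have e2 : ‖ρ - 3‖ ^ 2 = 10 - 6 * ρ.re := by
      have e3 : ‖ρ‖ ^ 2 = 1 := by rw [hρ]; norm_num
      simp only [Complex.sq_norm, Complex.normSq_apply] at *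
      simp; linarith
    nlinarith [sq_nonneg (‖1 + ρ‖ - 2)]
  nlinarith

theorem re_last_digit_le (hρ : ‖ρ‖ = 1) (hv : ‖v‖ = 1) :
    2 * ((1 + ρ + v) * (starRingEnd ℂ) (-(ρ * v))).re ≤ 2 * ‖1 + ρ‖ + 2 - ‖1 + ρ‖ ^ 2 := by
  have h0 := abs_le.1 (abs_re_mul_one_add_le (ρ := ρ) hv)
  rw [sq_norm_one_add hρ]
  have h1 : ‖ρ‖ ^ 2 = 1 := by rw [hρ]; norm_num
  have h2 : ‖v‖ ^ 2 = 1 := by rw [hv]; norm_num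
  have key : ((1 + ρ + v) * (starRingEnd ℂ) (-(ρ * v))).re =
      - (v.re + (ρ * v).re) - ρ.re := by
    simp only [Complex.sq_norm, Complex.normSq_apply] at *
    simp at *
    grind
  linarith [h0.1]

theorem sq_norm_left_outer_le (hρ : ‖ρ‖ = 1) (hv : ‖v‖ = 1) (hμ : ‖μ‖ = 1) {b : ℂ}
    (hb : ‖b‖ = ‖1 + ρ - v + μ‖) :
    ‖1 + ρ + v + b - ρ * v - μ‖ ^ 2 + ‖1 + ρ + v - b - μ‖ ^ 2 ≤ 45 := by
  have h0 := sq_norm_split_le (1 + ρ + v - μ) (-b) (-(ρ * v)) (by simp [hρ, hv])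
  have e1 : 1 + ρ + v - μ + -b = 1 + ρ + v - b - μ := by ring
  have e2 : 1 + ρ + v - μ - -b + -(ρ * v) = 1 + ρ + v + b - ρ * v - μ := by ring
  rw [e1, e2, norm_neg, hb] at h0
  have hs2 := norm_one_add_le hρ
  have hs0 := norm_nonneg (1 + ρ)
  have h2 := norm_one_add_sub_le (ρ := ρ) hv
  have h3 : ‖1 + ρ - v + μ‖ ≤ ‖1 + ρ - v‖ + 1 := by
    have := norm_add_le (1 + ρ - v) μ
    rwa [hμ] at this
  have h4 := re_last_digit_le hρ hv
  have h5 : ((1 + ρ + v - μ) * (starRingEnd ℂ) (-(ρ * v))).re ≤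
      ((1 + ρ + v) * (starRingEnd ℂ) (-(ρ * v))).re + 1 := by
    have := re_mul_conj_le (-μ) (-(ρ * v))
    rw [norm_neg, norm_neg, norm_mul, hμ, hρ, hv] at this
    rw [sub_eq_add_neg, add_mul, Complex.add_re]
    linarith
  have h6 : ‖1 + ρ + v - μ‖ ^ 2 + ‖1 + ρ - v + μ‖ ^ 2 ≤ 2 * ‖1 + ρ‖ ^ 2 + 8 := by
    -- Grouping `v - μ` makes the two vectors a sum and a difference, so no cross term is lost.
    have := parallelogram (1 + ρ) (v - μ)
    have h7 : ‖v - μ‖ ≤ 2 := by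
      have := norm_sub_le v μ
      rw [hv, hμ] at this
      linarith
    have e3 : 1 + ρ + (v - μ) = 1 + ρ + v - μ := by ring
    have e4 : 1 + ρ - (v - μ) = 1 + ρ - v + μ := by ring
    rw [e3, e4] at this
    nlinarith [norm_nonneg (v - μ)]
  nlinarith

theorem sq_norm_middle_right_le (hρ : ‖ρ‖ = 1) (hv : ‖v‖ = 1) (hμ : ‖μ‖ = 1) :
    ‖1 + ρ + v * (1 + μ) - ρ * v‖ ^ 2 + ‖1 + ρ - v * (1 + μ)‖ ^ 2 ≤ 20 := by
  have h0 := abs_le.1 (abs_re_mul_one_add_le (ρ := ρ) hv)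
  have hs2 := norm_one_add_le hρ
  have e0 := sq_norm_one_add hρ
  have h1 : ‖ρ‖ ^ 2 = 1 := by rw [hρ]; norm_num
  have h2 : ‖v‖ ^ 2 = 1 := by rw [hv]; norm_num
  have h3 : ‖μ‖ ^ 2 = 1 := by rw [hμ]; norm_num
  have h5 := re_mul_conj_le (2 - ρ) μ
  rw [hμ, mul_one] at h5
  have key : ‖1 + ρ + v * (1 + μ) - ρ * v‖ ^ 2 + ‖1 + ρ - v * (1 + μ)‖ ^ 2 =
      9 + 2 * ρ.re - 2 * (v.re + (ρ * v).re) + 2 * ((2 - ρ) * (starRingEnd ℂ) μ).re := by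
    simp only [Complex.sq_norm, Complex.normSq_apply] at h1 h2 h3 ⊢
    simp
    grind
  have h6 : ‖2 - ρ‖ ^ 2 = 5 - 4 * ρ.re := by
    simp only [Complex.sq_norm, Complex.normSq_apply] at h1 ⊢
    simp; linarith
  nlinarith [sq_nonneg (‖2 - ρ‖ - 2), h0.1]

/-- The mirror image of `sq_norm_middle_right_le`: exchange `ρ` and `μ`, and replace `v` by `-v⁻¹`.
-/
theorem sq_norm_middle_left_le (hρ : ‖ρ‖ = 1) (hv : ‖v‖ = 1) (hμ : ‖μ‖ = 1) :
    ‖1 + ρ + v * (1 + μ)‖ ^ 2 + ‖1 + ρ - v * (1 + μ) - μ‖ ^ 2 ≤ 20 := by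
  have hv0 : v ≠ 0 := norm_ne_zero_iff.1 (by rw [hv]; norm_num)
  have h := sq_norm_middle_right_le hμ (v := -v⁻¹) (by simp [hv]) hρ
  have e1 : 1 + μ + -v⁻¹ * (1 + ρ) - μ * -v⁻¹ = -v⁻¹ * (1 + ρ - v * (1 + μ) - μ) := by
    field_simp; ring
  have e2 : 1 + μ - -v⁻¹ * (1 + ρ) = v⁻¹ * (1 + ρ + v * (1 + μ)) := by
    field_simp; ring
  rw [e1, e2, norm_mul, norm_mul, norm_neg, norm_inv, hv, inv_one, one_mul, one_mul] at h
  linarith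

end coordinates

/-! ### The bounds by number of full blocks inside -/

theorem norm_add_one_le {a b : ℂ} (ha : ‖a‖ = 1) (hb : ‖b‖ = 1) : ‖a + b‖ ≤ 2 := by
  have := norm_add_le a b
  rw [ha, hb] at this
  linarith

theorem ne_zero_of_norm_eq_one {a : ℂ} (ha : ‖a‖ = 1) : a ≠ 0 :=
  norm_ne_zero_iff.1 (by rw [ha]; norm_num)

theorem le_or_exists_add_of_le_two_mul {t x : ℕ} (hx : x ≤ 2 ^ (t + 1)) :
    x ≤ 2 ^ t ∨ ∃ x', x = 2 ^ t + x' ∧ x' ≤ 2 ^ t := by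
  rcases le_total x (2 ^ t) with h | h
  · exact Or.inl h
  · obtain ⟨x', rfl⟩ := Nat.exists_eq_add_of_le h
    exact Or.inr ⟨x', rfl, by rw [pow_succ] at hx; omega⟩

theorem norm_unit_mul {u a : ℂ} (hu : ‖u‖ = 1) : ‖u * a‖ = ‖a‖ := by
  rw [norm_mul, hu, one_mul]

theorem exists_unit_mul_eq {a b : ℂ} (ha : ‖a‖ = 1) (hb : ‖b‖ = 1) :
    ∃ u : ℂ, ‖u‖ = 1 ∧ a * u = b :=
  ⟨b / a, by rw [norm_div, ha, hb, div_one], mul_div_cancel₀ b (ne_zero_of_norm_eq_one ha)⟩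

/-- Seven blocks inside, with a left digit added last. -/
theorem bound_seven {t : ℕ} (hB : ∀ t' ≤ t, S.Bounded t') {x y : ℕ} (hx : x ≤ 2 ^ t)
    (hy : y ≤ 2 ^ t) (hxy : 2 ^ t < x + y) {ρ v μ w : ℂ} (hρ : ‖ρ‖ = 1) (hv : ‖v‖ = 1)
    (hμ : ‖μ‖ = 1) (hw : ‖w‖ = 1) :
    ‖(1 + ρ + v) * S.v false t + w * (1 + ρ - v + μ) * S.v true t +
      -(ρ * v) * S.R false t x + -μ * S.L false t y‖ ^ 2 ≤ 10 * (7 * 2 ^ t + x + y) := by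
  have hρv : ‖-(ρ * v)‖ = 1 := by rw [norm_neg, norm_mul, hρ, hv, one_mul]
  have hμ' : ‖-μ‖ = 1 := by rw [norm_neg, hμ]
  rcases le_or_gt (1.31 * 2 ^ t) ((x : ℝ) + y) with h1 | h1
  · refine (hB t le_rfl).outer hx hy hρv hμ' (1 + ρ + v - ρ * v - μ) (w * (1 + ρ - v + μ)) 21 0.69
      (by ring) ?_ (by linarith) (by norm_num) (by norm_num)
    rw [norm_unit_mul hw]
    exact sq_norm_left_digit_outer_le hρ hv hμ
  -- At level 0 the remaining range contains no integer, so another splitting is always available.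
  rcases t with _ | t
  · have : x + y < 2 := by
      have : (x : ℝ) + y < 2 := by norm_num at h1; linarith
      exact_mod_cast this
    simp at hxy; omega
  have hBt := hB t (by omega)
  have hpos : (0 : ℝ) < 2 ^ t := by positivity
  -- Only the norm of the second coefficient is retained: its phase relative to the first is
  -- arbitrary once the factors `c`, `d`, `w` are absorbed.
  obtain ⟨b, hb, hcb⟩ : ∃ b : ℂ, ‖b‖ = ‖1 + ρ - v + μ‖ ∧
      S.c t * b = w * S.d t * (1 + ρ - v + μ) := by
    obtain ⟨u, hu, e⟩ := exists_unit_mul_eq (S.norm_c t) (S.norm_d t)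
    exact ⟨w * u * (1 + ρ - v + μ), by rw [mul_assoc, norm_unit_mul hw, norm_unit_mul hu],
      by linear_combination w * (1 + ρ - v + μ) * e⟩
  have hW := S.norm_w t
  have hρW : ‖-(ρ * v) * S.w t‖ = 1 := by rw [norm_mul, hρv, hW, one_mul]
  have hμW : ‖-μ * S.w t‖ = 1 := by rw [norm_mul, hμ', hW, one_mul]
  rcases le_or_exists_add_of_le_two_mul hx with hx' | ⟨x, rfl, hx'⟩ <;>
  rcases le_or_exists_add_of_le_two_mul hy with hy' | ⟨y, rfl, hy'⟩
  · rw [pow_succ] at hxy; omega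
  · have key : (1 + ρ + v) * S.v false (t + 1) + w * (1 + ρ - v + μ) * S.v true (t + 1) +
        -(ρ * v) * S.R false (t + 1) x + -μ * S.L false (t + 1) (2 ^ t + y) =
        S.c t * ((1 + ρ + v + b) * S.v false t + S.w t * (1 + ρ + v - b - μ) * S.v true t +
          -(ρ * v) * S.R false t x + -μ * S.L false t y) := by
      rw [S.v_false_succ, S.v_true_succ, S.R_false_low t x hx', S.L_false_high t y hy']
      linear_combination (-(S.v false t - S.w t * S.v true t)) * hcb
    rw [key, norm_unit_mul (S.norm_c t)]
    have hxy' : (2 : ℝ) ^ t ≤ (x : ℝ) + y := by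
      rw [pow_succ] at hxy
      exact_mod_cast (by omega : 2 ^ t ≤ x + y)
    -- Sharp choice: with `n = 45` and `s = 1` both sides of the numerical condition equal 900.
    have := hBt.outer hx' hy' hρv hμ' (M := 15) (α := 1 + ρ + v + b)
      (β := S.w t * (1 + ρ + v - b - μ)) (a := false) (b := false) (1 + ρ + v + b - ρ * v - μ)
      (S.w t * (1 + ρ + v - b - μ)) 45 1 (by ring)
      (by rw [norm_unit_mul hW]; exact sq_norm_left_outer_le hρ hv hμ hb)
      (by linarith) (by norm_num) (by norm_num)
    refine this.trans (le_of_eq ?_)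
    push_cast; ring
  · have key : (1 + ρ + v) * S.v false (t + 1) + w * (1 + ρ - v + μ) * S.v true (t + 1) +
        -(ρ * v) * S.R false (t + 1) (2 ^ t + x) + -μ * S.L false (t + 1) y =
        S.c t * ((1 + ρ + v - ρ * v + b) * S.v false t + S.w t * (1 + ρ + v - b) * S.v true t +
          -(ρ * v) * S.w t * S.R true t x + -μ * S.w t * S.L true t y) := by
      rw [S.v_false_succ, S.v_true_succ, S.R_false_high t x hx', S.L_false_low t y hy']
      linear_combination (-(S.v false t - S.w t * S.v true t)) * hcb
    rw [key, norm_unit_mul (S.norm_c t)]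
    have hxy' : (2 : ℝ) ^ t ≤ (x : ℝ) + y := by
      rw [pow_succ] at hxy
      exact_mod_cast (by omega : 2 ^ t ≤ x + y)
    have := hBt.outer hx' hy' hρW hμW (M := 15) (α := 1 + ρ + v - ρ * v + b)
      (β := S.w t * (1 + ρ + v - b)) (a := true) (b := true) (1 + ρ + v - ρ * v + b)
      (S.w t * (1 + ρ + v - ρ * v - b - μ)) 45 1 (by ring)
      (by rw [norm_unit_mul hW]; exact sq_norm_right_outer_le hρ hv hμ hb)
      (by linarith) (by norm_num) (by norm_num)
    refine this.trans (le_of_eq ?_)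
    push_cast; ring
  · have key : (1 + ρ + v) * S.v false (t + 1) + w * (1 + ρ - v + μ) * S.v true (t + 1) +
        -(ρ * v) * S.R false (t + 1) (2 ^ t + x) + -μ * S.L false (t + 1) (2 ^ t + y) =
        S.c t * ((1 + ρ + v + b + -(ρ * v)) * S.v false t +
          S.w t * (1 + ρ + v - b + -μ) * S.v true t +
          -(ρ * v) * S.w t * S.R true t x + -μ * S.L false t y) := by
      rw [S.v_false_succ, S.v_true_succ, S.R_false_high t x hx', S.L_false_high t y hy']
      linear_combination (-(S.v false t - S.w t * S.v true t)) * hcb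
    rw [key, norm_unit_mul (S.norm_c t)]
    push_cast at h1 ⊢
    rw [pow_succ] at h1
    -- With `k = 4` and the bound 17 this gives 52.5, within the 53 used below.
    have hn := sq_norm_add_add_sq_norm_sub_add_le (1 + ρ + v) b hρv hμ' (k := 4) (by norm_num)
    have h17 := sq_norm_left_digit_le hρ hv hμ
    rw [← hb] at h17
    have := hBt.inner hx' hy' hρW hμ' (M := 16) (n := 53) (α := 1 + ρ + v + b + -(ρ * v))
      (β := S.w t * (1 + ρ + v - b + -μ)) (a := true) (b := false)
      (by rw [norm_unit_mul hW]; linarith) (by norm_num) (by linarith)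
    refine this.trans (le_of_eq ?_)
    ring

/-- Three blocks inside, after a right digit has been added to a single block. -/
theorem bound_three {t : ℕ} (hB : ∀ t' ≤ t, S.Bounded t') {x y : ℕ} (hx : x ≤ 2 ^ t)
    (hy : y ≤ 2 ^ t) {ρ w l : ℂ} (hρ : ‖ρ‖ = 1) (hw : ‖w‖ = 1) (hl : ‖l‖ = 1) :
    ‖(1 + ρ) * S.v false t + w * S.v true t + -(ρ * w) * S.R true t x + l * S.L true t y‖ ^ 2 ≤
      10 * (3 * 2 ^ t + x + y) := by
  have hρw : ‖-(ρ * w)‖ = 1 := by rw [norm_neg, norm_mul, hρ, hw, one_mul]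
  have hs := norm_one_add_le hρ
  have hs0 := norm_nonneg (1 + ρ)
  rcases le_or_gt ((x : ℝ) + y) (2 ^ t) with h1 | h1
  · exact (hB t le_rfl).inner hx hy hρw hl (n := 5) (by rw [hw]; nlinarith) (by norm_num)
      (by linarith)
  -- The inner bound reaches 1 and the outer bound starts at 1.421; only the gap is split further.
  rcases le_or_gt (1.421 * 2 ^ t) ((x : ℝ) + y) with h2 | h2
  · refine (hB t le_rfl).outer hx hy hρw hl (1 + ρ) (w * (1 - ρ) + l) 9 0.579
      (by ring) ?_ (by linarith) (by norm_num) (by norm_num)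
    have h3 := parallelogram 1 ρ
    have h4 := sq_norm_add_le (a := w * (1 - ρ)) hl
    rw [norm_unit_mul hw] at h4
    rw [norm_one, hρ] at h3
    have h5 : ‖1 - ρ‖ ≤ 2 := by
      have := norm_sub_le 1 ρ
      rw [norm_one, hρ] at this
      linarith
    linarith
  have hxy : 2 ^ t < x + y := by exact_mod_cast h1
  rcases t with _ | t
  · have : x + y < 2 := by
      have : (x : ℝ) + y < 2 := by norm_num at h2; linarith
      exact_mod_cast this
    simp at hxy; omega
  have hBt := hB t (by omega)
  have hpos : (0 : ℝ) < 2 ^ t := by positivity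
  obtain ⟨u, hu, hcu⟩ := exists_unit_mul_eq (S.norm_c t) (S.norm_d t)
  obtain ⟨v, hv, hcv⟩ : ∃ v : ℂ, ‖v‖ = 1 ∧ S.c t * v = w * S.d t :=
    ⟨w * u, by rw [norm_unit_mul hw, hu], by linear_combination w * hcu⟩
  obtain ⟨μ, hμ, hcμ⟩ : ∃ μ : ℂ, ‖μ‖ = 1 ∧ S.c t * μ = -(l * S.d t) :=
    ⟨-(l * u), by rw [norm_neg, norm_unit_mul hl, hu], by linear_combination -l * hcu⟩
  have hW := S.norm_w t
  have hρv : ‖ρ * v‖ = 1 := by rw [norm_mul, hρ, hv, one_mul]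
  have hμ' : ‖-μ‖ = 1 := by rw [norm_neg, hμ]
  have hρW : ‖ρ * v * S.w t‖ = 1 := by rw [norm_mul, hρv, hW, one_mul]
  have hμW : ‖μ * S.w t‖ = 1 := by rw [norm_mul, hμ, hW, one_mul]
  rcases le_or_exists_add_of_le_two_mul hx with hx' | ⟨x, rfl, hx'⟩ <;>
  rcases le_or_exists_add_of_le_two_mul hy with hy' | ⟨y, rfl, hy'⟩
  · rw [pow_succ] at hxy; omega
  · have key : (1 + ρ) * S.v false (t + 1) + w * S.v true (t + 1) +
        -(ρ * w) * S.R true (t + 1) x + l * S.L true (t + 1) (2 ^ t + y) =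
        S.c t * ((1 + ρ + v) * S.v false t + S.w t * (1 + ρ - v + μ) * S.v true t +
          -(ρ * v) * S.R false t x + -μ * S.L false t y) := by
      rw [S.v_false_succ, S.v_true_succ, S.R_true_low t x hx', S.L_true_high t y hy']
      linear_combination (-(S.v false t - S.w t * S.v true t - ρ * S.R false t x)) * hcv -
        (S.w t * S.v true t - S.L false t y) * hcμ
    rw [key, norm_unit_mul (S.norm_c t)]
    -- A right piece below the midpoint adds no full block, so the inner bound falls short on part
    -- of the range; this case needs the deeper splitting.
    have := bound_seven (fun t' h => hB t' (by omega)) hx' hy'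
      (by rw [pow_succ] at hxy; omega) hρ hv hμ hW
    refine this.trans (le_of_eq ?_)
    push_cast; ring
  · have key : (1 + ρ) * S.v false (t + 1) + w * S.v true (t + 1) +
        -(ρ * w) * S.R true (t + 1) (2 ^ t + x) + l * S.L true (t + 1) y =
        S.c t * ((1 + ρ + v - ρ * v) * S.v false t + S.w t * (1 + ρ - v) * S.v true t +
          ρ * v * S.w t * S.R true t x + μ * S.w t * S.L true t y) := by
      rw [S.v_false_succ, S.v_true_succ, S.R_true_high t x hx', S.L_true_low t y hy']
      linear_combination (-(S.v false t - S.w t * S.v true t -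
        ρ * (S.v false t - S.w t * S.R true t x))) * hcv - (S.w t * S.L true t y) * hcμ
    rw [key, norm_unit_mul (S.norm_c t)]
    push_cast at h2 ⊢
    rw [pow_succ] at h2
    have := hBt.inner hx' hy' hρW hμW (M := 7) (n := 13) (α := 1 + ρ + v - ρ * v)
      (β := S.w t * (1 + ρ - v)) (a := true) (b := true)
      (by rw [norm_unit_mul hW]; exact sq_norm_digit_le hρ hv) (by norm_num) (by linarith)
    refine this.trans (le_of_eq ?_)
    ring
  · have key : (1 + ρ) * S.v false (t + 1) + w * S.v true (t + 1) +
        -(ρ * w) * S.R true (t + 1) (2 ^ t + x) + l * S.L true (t + 1) (2 ^ t + y) =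
        S.c t * ((1 + ρ + v - ρ * v) * S.v false t + S.w t * (1 + ρ - v + μ) * S.v true t +
          ρ * v * S.w t * S.R true t x + -μ * S.L false t y) := by
      rw [S.v_false_succ, S.v_true_succ, S.R_true_high t x hx', S.L_true_high t y hy']
      linear_combination (-(S.v false t - S.w t * S.v true t -
        ρ * (S.v false t - S.w t * S.R true t x))) * hcv -
        (S.w t * S.v true t - S.L false t y) * hcμ
    rw [key, norm_unit_mul (S.norm_c t)]
    push_cast at h2 ⊢
    rw [pow_succ] at h2
    have := hBt.inner hx' hy' hρW hμ' (M := 8) (n := 20) (α := 1 + ρ + v - ρ * v)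
      (β := S.w t * (1 + ρ - v + μ)) (a := true) (b := false)
      (by rw [norm_unit_mul hW]; exact sq_norm_two_digits_le hρ hv hμ) (by norm_num) (by linarith)
    refine this.trans (le_of_eq ?_)
    ring

/-- Four blocks inside, after both digits have been added to a single block. -/
theorem bound_four {t : ℕ} (hB : ∀ t' ≤ t + 1, S.Bounded t') {x y : ℕ} (hx : x ≤ 2 ^ (t + 1))
    (hy : y ≤ 2 ^ (t + 1)) {ρ w μ : ℂ} (hρ : ‖ρ‖ = 1) (hw : ‖w‖ = 1) (hμ : ‖μ‖ = 1) :
    ‖(1 + ρ) * S.v false (t + 1) + w * (1 + μ) * S.v true (t + 1) +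
      -(ρ * w) * S.R true (t + 1) x + -μ * S.L false (t + 1) y‖ ^ 2 ≤
      10 * (4 * 2 ^ (t + 1) + x + y) := by
  have hρw : ‖-(ρ * w)‖ = 1 := by rw [norm_neg, norm_mul, hρ, hw, one_mul]
  have hμ' : ‖-μ‖ = 1 := by rw [norm_neg, hμ]
  have hs := norm_one_add_le hρ
  have hs0 := norm_nonneg (1 + ρ)
  have hm := norm_one_add_le hμ
  have hm0 := norm_nonneg (1 + μ)
  rcases le_or_gt ((x : ℝ) + y) (0.9 * 2 ^ (t + 1)) with h1 | h1
  · exact (hB _ le_rfl).inner hx hy hρw hμ' (n := 8) (by rw [norm_unit_mul hw]; nlinarith)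
      (by norm_num) (by linarith)
  rcases le_or_gt (1.237 * 2 ^ (t + 1)) ((x : ℝ) + y) with h2 | h2
  · refine (hB _ le_rfl).outer hx hy hρw hμ' (1 + (ρ - μ)) (w * (1 - (ρ - μ))) 10 0.763
      (by ring) ?_ (by linarith) (by norm_num) (by norm_num)
    have h3 := parallelogram 1 (ρ - μ)
    have h5 : ‖ρ - μ‖ ≤ 2 := by
      have := norm_sub_le ρ μ
      rw [hμ, hρ] at this
      linarith
    rw [norm_unit_mul hw]
    rw [norm_one] at h3
    nlinarith [norm_nonneg (ρ - μ)]
  have hBt := hB t (by omega)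
  have hpos : (0 : ℝ) < 2 ^ t := by positivity
  obtain ⟨u, hu, hcu⟩ := exists_unit_mul_eq (S.norm_c t) (S.norm_d t)
  obtain ⟨v, hv, hcv⟩ : ∃ v : ℂ, ‖v‖ = 1 ∧ S.c t * v = w * S.d t :=
    ⟨w * u, by rw [norm_unit_mul hw, hu], by linear_combination w * hcu⟩
  have hW := S.norm_w t
  have hρv : ‖ρ * v‖ = 1 := by rw [norm_mul, hρ, hv, one_mul]
  have hρv' : ‖-(ρ * v)‖ = 1 := by rw [norm_neg, hρv]
  have hρW : ‖ρ * v * S.w t‖ = 1 := by rw [norm_mul, hρv, hW, one_mul]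
  have hμW : ‖-μ * S.w t‖ = 1 := by rw [norm_mul, hμ', hW, one_mul]
  -- With `k = 3` this gives at most `88 / 3`. It serves both the case where no digit is added
  -- (completed outward) and the case where both are (kept inside), since the coefficients agree.
  have hcrude := sq_norm_add_add_sq_norm_sub_add_le (1 + ρ) (v * (1 + μ)) hρv' hμ'
    (k := 3) (by norm_num)
  have h30 : ‖1 + ρ + v * (1 + μ) + -(ρ * v)‖ ^ 2 + ‖1 + ρ - v * (1 + μ) + -μ‖ ^ 2 ≤ 30 := by
    rw [norm_unit_mul hv] at hcrude
    nlinarith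
  rw [pow_succ] at h1 h2
  rcases le_or_exists_add_of_le_two_mul hx with hx' | ⟨x, rfl, hx'⟩ <;>
  rcases le_or_exists_add_of_le_two_mul hy with hy' | ⟨y, rfl, hy'⟩
  · have key : (1 + ρ) * S.v false (t + 1) + w * (1 + μ) * S.v true (t + 1) +
        -(ρ * w) * S.R true (t + 1) x + -μ * S.L false (t + 1) y =
        S.c t * ((1 + ρ + v * (1 + μ)) * S.v false t +
          S.w t * (1 + ρ - v * (1 + μ)) * S.v true t +
          -(ρ * v) * S.R false t x + -μ * S.w t * S.L true t y) := by
      rw [S.v_false_succ, S.v_true_succ, S.R_true_low t x hx', S.L_false_low t y hy']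
      linear_combination (-((1 + μ) * (S.v false t - S.w t * S.v true t) -
        ρ * S.R false t x)) * hcv
    rw [key, norm_unit_mul (S.norm_c t)]
    have := hBt.outer hx' hy' hρv' hμW (M := 8) (α := 1 + ρ + v * (1 + μ))
      (β := S.w t * (1 + ρ - v * (1 + μ))) (a := false) (b := true)
      (1 + ρ + v * (1 + μ) + -(ρ * v)) (S.w t * (1 + ρ - v * (1 + μ) + -μ)) 30 0.2 (by ring)
      (by rw [norm_unit_mul hW]; exact h30)
      (by linarith) (by norm_num) (by norm_num)
    refine this.trans (le_of_eq ?_)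
    ring
  · have key : (1 + ρ) * S.v false (t + 1) + w * (1 + μ) * S.v true (t + 1) +
        -(ρ * w) * S.R true (t + 1) x + -μ * S.L false (t + 1) (2 ^ t + y) =
        S.c t * ((1 + ρ + v * (1 + μ)) * S.v false t +
          S.w t * (1 + ρ - v * (1 + μ) - μ) * S.v true t +
          -(ρ * v) * S.R false t x + -μ * S.L false t y) := by
      rw [S.v_false_succ, S.v_true_succ, S.R_true_low t x hx', S.L_false_high t y hy']
      linear_combination (-((1 + μ) * (S.v false t - S.w t * S.v true t) -
        ρ * S.R false t x)) * hcv
    rw [key, norm_unit_mul (S.norm_c t)]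
    push_cast at h2 ⊢
    have := hBt.inner hx' hy' hρv' hμ' (M := 9) (n := 20) (α := 1 + ρ + v * (1 + μ))
      (β := S.w t * (1 + ρ - v * (1 + μ) - μ)) (a := false) (b := false)
      (by rw [norm_unit_mul hW]; exact sq_norm_middle_left_le hρ hv hμ) (by norm_num) (by linarith)
    refine this.trans (le_of_eq ?_)
    ring
  · have key : (1 + ρ) * S.v false (t + 1) + w * (1 + μ) * S.v true (t + 1) +
        -(ρ * w) * S.R true (t + 1) (2 ^ t + x) + -μ * S.L false (t + 1) y =
        S.c t * ((1 + ρ + v * (1 + μ) - ρ * v) * S.v false t +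
          S.w t * (1 + ρ - v * (1 + μ)) * S.v true t +
          ρ * v * S.w t * S.R true t x + -μ * S.w t * S.L true t y) := by
      rw [S.v_false_succ, S.v_true_succ, S.R_true_high t x hx', S.L_false_low t y hy']
      linear_combination (-((1 + μ) * (S.v false t - S.w t * S.v true t) -
        ρ * (S.v false t - S.w t * S.R true t x))) * hcv
    rw [key, norm_unit_mul (S.norm_c t)]
    push_cast at h2 ⊢
    have := hBt.inner hx' hy' hρW hμW (M := 9) (n := 20) (α := 1 + ρ + v * (1 + μ) - ρ * v)
      (β := S.w t * (1 + ρ - v * (1 + μ))) (a := true) (b := true)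
      (by rw [norm_unit_mul hW]; exact sq_norm_middle_right_le hρ hv hμ) (by norm_num)
      (by linarith)
    refine this.trans (le_of_eq ?_)
    ring
  · have key : (1 + ρ) * S.v false (t + 1) + w * (1 + μ) * S.v true (t + 1) +
        -(ρ * w) * S.R true (t + 1) (2 ^ t + x) + -μ * S.L false (t + 1) (2 ^ t + y) =
        S.c t * ((1 + ρ + v * (1 + μ) + -(ρ * v)) * S.v false t +
          S.w t * (1 + ρ - v * (1 + μ) + -μ) * S.v true t +
          ρ * v * S.w t * S.R true t x + -μ * S.L false t y) := by
      rw [S.v_false_succ, S.v_true_succ, S.R_true_high t x hx', S.L_false_high t y hy']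
      linear_combination (-((1 + μ) * (S.v false t - S.w t * S.v true t) -
        ρ * (S.v false t - S.w t * S.R true t x))) * hcv
    rw [key, norm_unit_mul (S.norm_c t)]
    push_cast at h2 ⊢
    have := hBt.inner hx' hy' hρW hμ' (M := 10) (n := 30) (α := 1 + ρ + v * (1 + μ) + -(ρ * v))
      (β := S.w t * (1 + ρ - v * (1 + μ) + -μ)) (a := true) (b := false)
      (by rw [norm_unit_mul hW]; exact h30) (by norm_num) (by linarith)
    refine this.trans (le_of_eq ?_)
    ring

/-- One block inside. -/
theorem bound_one {t : ℕ} (hB : ∀ S : GolaySystem, ∀ t' ≤ t + 2, S.Bounded t') {x y : ℕ}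
    (hx : x ≤ 2 ^ (t + 2)) (hy : y ≤ 2 ^ (t + 2)) {e ρ l : ℂ} (he : ‖e‖ = 1) (hρ : ‖ρ‖ = 1)
    (hl : ‖l‖ = 1) :
    ‖e * S.v false (t + 2) + ρ * S.R true (t + 2) x + l * S.L true (t + 2) y‖ ^ 2 ≤
      10 * (2 ^ (t + 2) + x + y) := by
  rcases le_or_gt ((x : ℝ) + y) (0.8 * 2 ^ (t + 2)) with h1 | h1
  · have := (hB S (t + 2) le_rfl).inner hx hy hρ hl (M := 1) (n := 1) (α := e) (β := 0) (a := true)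
      (b := true) (by simp [he]) (by norm_num) (by linarith)
    simpa using this
  have hB' : ∀ S : GolaySystem, ∀ t' ≤ t + 1, S.Bounded t' := fun S t' h => hB S t' (by omega)
  obtain ⟨u, hu, hcu⟩ := exists_unit_mul_eq (S.norm_c (t + 1)) (S.norm_d (t + 1))
  have hc := S.norm_c (t + 1)
  have hW := S.norm_w (t + 1)
  have hWi := S.w_mul_inv (t + 1)
  have hec : ‖e * S.c (t + 1)‖ = 1 := by rw [norm_mul, he, hc, one_mul]
  have hecW : ‖e * S.c (t + 1) * S.w (t + 1)‖ = 1 := by rw [norm_mul, hec, hW, one_mul]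
  obtain ⟨ρ₀, hρ₀, eρ⟩ : ∃ r : ℂ, ‖r‖ = 1 ∧ e * S.c (t + 1) * r = ρ * S.d (t + 1) :=
    exists_unit_mul_eq hec (by rw [norm_mul, hρ, S.norm_d, one_mul])
  obtain ⟨μ, hμ, eμ⟩ : ∃ r : ℂ, ‖r‖ = 1 ∧ e * S.c (t + 1) * r = -(l * S.d (t + 1)) :=
    exists_unit_mul_eq hec (by rw [norm_neg, norm_mul, hl, S.norm_d, one_mul])
  rcases le_or_exists_add_of_le_two_mul hx with hx' | ⟨x, rfl, hx'⟩ <;>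
  rcases le_or_exists_add_of_le_two_mul hy with hy' | ⟨y, rfl, hy'⟩
  · have key : e * S.v false (t + 2) + ρ * S.R true (t + 2) x + l * S.L true (t + 2) y =
        e * S.c (t + 1) * (1 * S.v false (t + 1) + S.w (t + 1) * S.v true (t + 1) +
          ρ₀ * S.R false (t + 1) x + μ * S.w (t + 1) * S.L true (t + 1) y) := by
      rw [S.v_false_succ, S.R_true_low _ x hx', S.L_true_low _ y hy']
      linear_combination (-S.R false (t + 1) x) * eρ - S.w (t + 1) * S.L true (t + 1) y * eμ
    rw [key, norm_unit_mul hec]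
    -- More than 0.8 of a block is more than 1.6 of a half block, so the complements have total
    -- length at most 0.4 of a half block.
    rw [pow_succ _ (t + 1)] at h1
    have := (hB S (t + 1) (by omega)).outer hx' hy' hρ₀ (l := μ * S.w (t + 1))
      (by rw [norm_mul, hμ, hW, one_mul]) (M := 2) (α := 1) (β := S.w (t + 1)) (a := false)
      (b := true) (1 + ρ₀) (S.w (t + 1) * (1 + μ)) 8 0.4 (by ring)
      (by
        rw [norm_unit_mul hW]
        nlinarith [norm_one_add_le hρ₀, norm_one_add_le hμ, norm_nonneg (1 + ρ₀),
          norm_nonneg (1 + μ)])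
      (by linarith) (by norm_num) (by norm_num)
    refine this.trans (le_of_eq ?_)
    ring
  · have key : e * S.v false (t + 2) + ρ * S.R true (t + 2) x +
          l * S.L true (t + 2) (2 ^ (t + 1) + y) =
        e * S.c (t + 1) * S.w (t + 1) *
          ((1 + μ) * S.swap.v false (t + 1) + (S.w (t + 1))⁻¹ * S.swap.v true (t + 1) +
          -(μ * (S.w (t + 1))⁻¹) * S.swap.R true (t + 1) y +
          ρ₀ * (S.w (t + 1))⁻¹ * S.swap.L true (t + 1) x) := by
      change _ = e * S.c (t + 1) * S.w (t + 1) *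
          ((1 + μ) * S.v true (t + 1) + (S.w (t + 1))⁻¹ * S.v false (t + 1) +
          -(μ * (S.w (t + 1))⁻¹) * S.L false (t + 1) y +
          ρ₀ * (S.w (t + 1))⁻¹ * S.R false (t + 1) x)
      rw [S.v_false_succ, S.R_true_low _ x hx', S.L_true_high _ y hy']
      linear_combination (-S.R false (t + 1) x) * eρ -
        (S.w (t + 1) * S.v true (t + 1) - S.L false (t + 1) y) * eμ -
        e * S.c (t + 1) * (S.v false (t + 1) - μ * S.L false (t + 1) y +
          ρ₀ * S.R false (t + 1) x) * hWi
    rw [key, norm_unit_mul hecW]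
    -- Only the final segment passes the midpoint; read backwards, this is the case of
    -- `bound_three`.
    have := bound_three (hB' S.swap) hy' hx' hμ (w := (S.w (t + 1))⁻¹)
      (l := ρ₀ * (S.w (t + 1))⁻¹) (by rw [norm_inv, hW, inv_one])
      (by rw [norm_mul, norm_inv, hW, hρ₀, inv_one, one_mul])
    refine this.trans (le_of_eq ?_)
    push_cast; ring
  · have key : e * S.v false (t + 2) + ρ * S.R true (t + 2) (2 ^ (t + 1) + x) +
          l * S.L true (t + 2) y =
        e * S.c (t + 1) * ((1 + ρ₀) * S.v false (t + 1) + S.w (t + 1) * S.v true (t + 1) +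
          -(ρ₀ * S.w (t + 1)) * S.R true (t + 1) x +
          μ * S.w (t + 1) * S.L true (t + 1) y) := by
      rw [S.v_false_succ, S.R_true_high _ x hx', S.L_true_low _ y hy']
      linear_combination (-(S.v false (t + 1) - S.w (t + 1) * S.R true (t + 1) x)) * eρ -
        S.w (t + 1) * S.L true (t + 1) y * eμ
    rw [key, norm_unit_mul hec]
    have := bound_three (hB' S) hx' hy' hρ₀ hW (l := μ * S.w (t + 1))
      (by rw [norm_mul, hμ, hW, one_mul])
    refine this.trans (le_of_eq ?_)
    push_cast; ring
  · have key : e * S.v false (t + 2) + ρ * S.R true (t + 2) (2 ^ (t + 1) + x) +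
          l * S.L true (t + 2) (2 ^ (t + 1) + y) =
        e * S.c (t + 1) * ((1 + ρ₀) * S.v false (t + 1) +
          S.w (t + 1) * (1 + μ) * S.v true (t + 1) +
          -(ρ₀ * S.w (t + 1)) * S.R true (t + 1) x + -μ * S.L false (t + 1) y) := by
      rw [S.v_false_succ, S.R_true_high _ x hx', S.L_true_high _ y hy']
      linear_combination (-(S.v false (t + 1) - S.w (t + 1) * S.R true (t + 1) x)) * eρ -
        (S.w (t + 1) * S.v true (t + 1) - S.L false (t + 1) y) * eμ
    rw [key, norm_unit_mul hec]
    have := bound_four (hB' S) hx' hy' hρ₀ hW hμ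
    refine this.trans (le_of_eq ?_)
    push_cast; ring

/-- Two blocks inside, one on each side of the splitting point. -/
theorem bound_two {t : ℕ} (hB : S.Bounded t) {x y : ℕ} (hx : x ≤ 2 ^ t) (hy : y ≤ 2 ^ t)
    {α β ρ l : ℂ} (hα : ‖α‖ = 1) (hβ : ‖β‖ = 1) (hρ : ‖ρ‖ = 1) (hl : ‖l‖ = 1) :
    ‖α * S.v false t + β * S.v true t + ρ * S.R true t x + l * S.L false t y‖ ^ 2 ≤
      10 * (2 * 2 ^ t + x + y) := by
  -- With the constant 10 the inner and outer ranges meet exactly at 1.6, each with equality.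
  rcases le_or_gt ((x : ℝ) + y) (1.6 * 2 ^ t) with h1 | h1
  · exact hB.inner hx hy hρ hl (n := 2) (by rw [hα, hβ]; norm_num) (by norm_num) (by linarith)
  · refine hB.outer hx hy hρ hl (α + l) (β + ρ) 8 0.4 (by ring) ?_ (by linarith) (by norm_num)
      (by norm_num)
    nlinarith [norm_add_one_le hα hl, norm_add_one_le hβ hρ, norm_nonneg (α + l),
      norm_nonneg (β + ρ)]

/-! ### Closing the induction; arbitrary segments -/

theorem exists_R_low (S : GolaySystem) (b : Bool) {t x : ℕ} (hx : x ≤ 2 ^ t) :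
    ∃ u : ℂ, ‖u‖ = 1 ∧ S.R b (t + 1) x = u * S.R false t x := by
  cases b
  · exact ⟨S.c t, S.norm_c t, S.R_false_low t x hx⟩
  · exact ⟨S.d t, S.norm_d t, S.R_true_low t x hx⟩

theorem exists_R_high (S : GolaySystem) (b : Bool) {t x : ℕ} (hx : x ≤ 2 ^ t) :
    ∃ u e : ℂ, ‖u‖ = 1 ∧ ‖e‖ = 1 ∧
      S.R b (t + 1) (2 ^ t + x) = u * S.v false t + e * S.R true t x := by
  cases b
  · exact ⟨S.c t, S.c t * S.w t, S.norm_c t, by rw [norm_mul, S.norm_c, S.norm_w, one_mul],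
      by rw [S.R_false_high t x hx]; ring⟩
  · exact ⟨S.d t, -(S.d t * S.w t), S.norm_d t,
      by rw [norm_neg, norm_mul, S.norm_d, S.norm_w, one_mul],
      by rw [S.R_true_high t x hx]; ring⟩

theorem exists_unit_mul_eq_norm (a : ℂ) : ∃ u : ℂ, ‖u‖ = 1 ∧ u * a = ‖a‖ := by
  rcases eq_or_ne a 0 with rfl | ha
  · exact ⟨1, by simp, by simp⟩
  · have h : (‖a‖ : ℂ) ≠ 0 := by exact_mod_cast norm_ne_zero_iff.2 ha
    exact ⟨‖a‖ / a, by rw [norm_div, Complex.norm_real, norm_norm, div_self (norm_ne_zero_iff.2 ha)],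
      div_mul_cancel₀ _ ha⟩

/-- Rotating both terms onto the positive axis turns the sum of norms into a single norm, the form
the block bounds treat. -/
theorem norm_add_norm_le_sqrt {a b : ℂ} {s : ℝ}
    (h : ∀ ρ l : ℂ, ‖ρ‖ = 1 → ‖l‖ = 1 → ‖ρ * a + l * b‖ ^ 2 ≤ s) : ‖a‖ + ‖b‖ ≤ √s := by
  obtain ⟨ρ, hρ, e1⟩ := exists_unit_mul_eq_norm a
  obtain ⟨l, hl, e2⟩ := exists_unit_mul_eq_norm b
  have := h ρ l hρ hl
  rw [e1, e2, ← Complex.ofReal_add, Complex.norm_real, Real.norm_eq_abs, sq_abs] at this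
  exact Real.le_sqrt_of_sq_le this

theorem bounded (S : GolaySystem) (t : ℕ) : S.Bounded t := by
  induction t using Nat.strong_induction_on generalizing S with
  | _ t ih =>
  intro a b x y hx hy
  -- The trivial bound suffices for `x + y ≤ 10`, and here `x + y ≤ 8`. From level 3 on there is
  -- room for the splittings in `bound_one` and `bound_four`.
  by_cases ht : t ≤ 2
  · have h1 := S.norm_R_le a t x hx
    have h2 := S.norm_L_le b t y hy
    have h3 : 2 ^ t ≤ 2 ^ 2 := Nat.pow_le_pow_right (by norm_num) ht
    have h4 : (x : ℝ) + y ≤ 8 := by exact_mod_cast (by omega : x + y ≤ 8)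
    have h5 : (0 : ℝ) ≤ (x : ℝ) + y := by positivity
    refine (add_le_add h1 h2).trans (Real.le_sqrt_of_sq_le ?_)
    nlinarith
  obtain ⟨k, rfl⟩ : ∃ k, t = k + 3 := ⟨t - 3, by omega⟩
  have hB : ∀ S : GolaySystem, ∀ t' ≤ k + 2, S.Bounded t' := fun S t' h => ih t' (by omega) S
  rcases le_or_exists_add_of_le_two_mul hx with hx' | ⟨x, rfl, hx'⟩ <;>
  rcases le_or_exists_add_of_le_two_mul hy with hy' | ⟨y, rfl, hy'⟩
  · obtain ⟨u, hu, e1⟩ := S.exists_R_low a hx'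
    obtain ⟨f, hf, e2⟩ := S.swap.exists_R_low (!b) hy'
    simp only [swap, Bool.not_not, Bool.not_false] at e2
    rw [e1, e2, norm_unit_mul hu, norm_unit_mul hf]
    exact hB S _ le_rfl _ _ x y hx' hy'
  · obtain ⟨u, hu, e1⟩ := S.exists_R_low a hx'
    obtain ⟨f, g, hf, hg, e2⟩ := S.swap.exists_R_high (!b) hy'
    have e3 : S.L b (k + 2 + 1) (2 ^ (k + 2) + y) = S.swap.R (!b) (k + 2 + 1) (2 ^ (k + 2) + y) := by
      simp [swap]
    refine norm_add_norm_le_sqrt fun ρ l hρ hl => ?_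
    rw [e1, e3, e2]
    have := bound_one (S := S.swap) hB hy' hx' (e := l * f) (ρ := l * g) (l := ρ * u)
      (by rw [norm_mul, hl, hf, one_mul]) (by rw [norm_mul, hl, hg, one_mul])
      (by rw [norm_mul, hρ, hu, one_mul])
    refine le_trans (le_of_eq ?_) (this.trans (le_of_eq ?_))
    · congr 2
      change _ = l * f * S.swap.v false (k + 2) + l * g * S.swap.R true (k + 2) y +
        ρ * u * S.R false (k + 2) x
      ring
    · push_cast; ring
  · obtain ⟨u, e, hu, he, e1⟩ := S.exists_R_high a hx'
    obtain ⟨f, hf, e2⟩ := S.swap.exists_R_low (!b) hy'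
    simp only [swap, Bool.not_not, Bool.not_false] at e2
    refine norm_add_norm_le_sqrt fun ρ l hρ hl => ?_
    rw [e1, e2]
    have := bound_one (S := S) hB hx' hy' (e := ρ * u) (ρ := ρ * e) (l := l * f)
      (by rw [norm_mul, hρ, hu, one_mul]) (by rw [norm_mul, hρ, he, one_mul])
      (by rw [norm_mul, hl, hf, one_mul])
    refine le_trans (le_of_eq ?_) (this.trans (le_of_eq ?_))
    · congr 2; ring
    · push_cast; ring
  · obtain ⟨u, e, hu, he, e1⟩ := S.exists_R_high a hx'
    obtain ⟨f, g, hf, hg, e2⟩ := S.swap.exists_R_high (!b) hy'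
    simp only [swap, Bool.not_not, Bool.not_false, Bool.not_true] at e2
    refine norm_add_norm_le_sqrt fun ρ l hρ hl => ?_
    rw [e1, e2]
    have := bound_two (hB S (k + 2) le_rfl) hx' hy' (α := ρ * u) (β := l * f) (ρ := ρ * e)
      (l := l * g)
      (by rw [norm_mul, hρ, hu, one_mul]) (by rw [norm_mul, hl, hf, one_mul])
      (by rw [norm_mul, hρ, he, one_mul]) (by rw [norm_mul, hl, hg, one_mul])
    refine le_trans (le_of_eq ?_) (this.trans (le_of_eq ?_))
    · congr 2; ring
    · push_cast; ring

/-- The bound for an arbitrary segment of a block. -/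
theorem norm_R_sub_R_le (S : GolaySystem) (b : Bool) (t : ℕ) {m n : ℕ} (hmn : m ≤ n)
    (hn : n ≤ 2 ^ t) : ‖S.R b t n - S.R b t m‖ ≤ √(10 * ((n : ℝ) - m)) := by
  induction t generalizing b m n with
  | zero =>
    rcases hmn.eq_or_lt with rfl | h
    · simp
    · obtain ⟨rfl, rfl⟩ : m = 0 ∧ n = 1 := by rw [pow_zero] at hn; omega
      have h1 := S.norm_R_le b 0 1 (by norm_num)
      have h2 := S.norm_R_le b 0 0 (by norm_num)
      refine (norm_sub_le _ _).trans (Real.le_sqrt_of_sq_le ?_)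
      push_cast at h1 h2 ⊢
      nlinarith [norm_nonneg (S.R b 0 1), norm_nonneg (S.R b 0 0)]
  | succ t ih =>
    rcases le_or_exists_add_of_le_two_mul hn with hn' | ⟨n, rfl, hn'⟩
    · cases b
      · rw [S.R_false_low t n hn', S.R_false_low t m (hmn.trans hn'), ← mul_sub,
          norm_unit_mul (S.norm_c t)]
        exact ih false hmn hn'
      · rw [S.R_true_low t n hn', S.R_true_low t m (hmn.trans hn'), ← mul_sub,
          norm_unit_mul (S.norm_d t)]
        exact ih false hmn hn'
    rcases le_or_exists_add_of_le_two_mul (hmn.trans hn) with hm' | ⟨m, rfl, hm'⟩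
    · obtain ⟨k, hk⟩ := Nat.exists_eq_add_of_le hm'
      have h1 := S.R_add_L false t m k hk.symm
      -- The segment straddles the midpoint: the last `k` terms of the left half and the first `n`
      -- of the right half.
      have h2 := S.bounded t true false n k hn' (by omega)
      have h3 : (2 : ℝ) ^ t = m + k := by exact_mod_cast hk
      have h4 : 10 * (((2 ^ t + n : ℕ) : ℝ) - m) = 10 * ((n : ℝ) + k) := by
        push_cast; linarith
      rw [h4]
      refine le_trans ?_ h2
      cases b
      · rw [S.R_false_high t n hn', S.R_false_low t m hm', ← h1, ← mul_sub,
          norm_unit_mul (S.norm_c t)]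
        have := norm_add_le (S.w t * S.R true t n) (S.L false t k)
        rw [norm_unit_mul (S.norm_w t)] at this
        refine le_trans (le_of_eq ?_) this
        congr 2; ring
      · rw [S.R_true_high t n hn', S.R_true_low t m hm', ← h1, ← mul_sub,
          norm_unit_mul (S.norm_d t)]
        have := norm_add_le (-(S.w t * S.R true t n)) (S.L false t k)
        rw [norm_neg, norm_unit_mul (S.norm_w t)] at this
        refine le_trans (le_of_eq ?_) this
        congr 2; ring
    · have h := ih true (m := m) (n := n) (by omega) hn'
      have h4 : 10 * (((2 ^ t + n : ℕ) : ℝ) - (2 ^ t + m : ℕ)) = 10 * ((n : ℝ) - m) := by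
        push_cast; ring
      rw [h4]
      refine le_trans (le_of_eq ?_) h
      cases b
      · rw [S.R_false_high t n hn', S.R_false_high t m hm', ← mul_sub,
          norm_unit_mul (S.norm_c t), add_sub_add_left_eq_sub, ← mul_sub,
          norm_unit_mul (S.norm_w t)]
      · rw [S.R_true_high t n hn', S.R_true_high t m hm', ← mul_sub,
          norm_unit_mul (S.norm_d t), sub_sub_sub_cancel_left, ← mul_sub,
          norm_unit_mul (S.norm_w t), norm_sub_rev]

end GolaySystem

/-! ### The Rudin–Shapiro polynomials as a block system -/

/-- The Rudin–Shapiro polynomials as a family indexed by a Boolean: `P_t` or `Q_t`. -/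
noncomputable def rudinShapiroBlock (b : Bool) (t : ℕ) : ℂ[X] :=
  if b then rudinShapiroQ t else rudinShapiroP t

theorem coeff_rudinShapiroBlock_of_le {t i : ℕ} (b : Bool) (hi : 2 ^ t ≤ i) :
    (rudinShapiroBlock b t).coeff i = 0 := by
  induction t generalizing b i with
  | zero =>
    have : i ≠ 0 := by rw [pow_zero] at hi; omega
    cases b <;> simp [rudinShapiroBlock, rudinShapiroP, rudinShapiroQ, rudinShapiroPair,
      coeff_one, this]
  | succ t ih =>
    rw [pow_succ] at hi
    have h1 := ih false (i := i) (by omega)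
    have h2 := ih true (i := i - 2 ^ t) (by omega)
    simp only [rudinShapiroBlock, Bool.false_eq_true, if_false, if_true] at h1 h2
    cases b <;> simp [rudinShapiroBlock, rudinShapiroP_succ, rudinShapiroQ_succ,
      coeff_X_pow_mul', h1, h2]

theorem coeff_rudinShapiroBlock_succ_low {t i : ℕ} (b : Bool) (hi : i < 2 ^ t) :
    (rudinShapiroBlock b (t + 1)).coeff i = (rudinShapiroBlock false t).coeff i := by
  cases b <;> simp [rudinShapiroBlock, rudinShapiroP_succ, rudinShapiroQ_succ,
      coeff_X_pow_mul', hi.not_ge]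

theorem coeff_rudinShapiroBlock_succ_high (b : Bool) (t i : ℕ) :
    (rudinShapiroBlock b (t + 1)).coeff (2 ^ t + i) =
      (if b then -1 else 1) * (rudinShapiroBlock true t).coeff i := by
  have h := coeff_rudinShapiroBlock_of_le (t := t) (i := 2 ^ t + i) false (by omega)
  simp only [rudinShapiroBlock, Bool.false_eq_true, if_false] at h
  cases b <;> simp [rudinShapiroBlock, rudinShapiroP_succ, rudinShapiroQ_succ,
      coeff_X_pow_mul', h]

theorem norm_coeff_rudinShapiroBlock_le (b : Bool) (t i : ℕ) :
    ‖(rudinShapiroBlock b t).coeff i‖ ≤ 1 := by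
  induction t generalizing b i with
  | zero =>
    cases b <;> by_cases h : i = 0 <;> simp [rudinShapiroBlock, rudinShapiroP, rudinShapiroQ,
      rudinShapiroPair, coeff_one, h]
  | succ t ih =>
    rcases lt_or_ge i (2 ^ t) with h | h
    · rw [coeff_rudinShapiroBlock_succ_low b h]; exact ih _ _
    · obtain ⟨j, rfl⟩ := Nat.exists_eq_add_of_le h
      rw [coeff_rudinShapiroBlock_succ_high]
      cases b <;> simpa using ih true j

/-- The sum over the first `x` terms of a Rudin–Shapiro polynomial. -/
noncomputable def rudinShapiroInit (z : ℂ) (b : Bool) (t x : ℕ) : ℂ :=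
  ∑ i ∈ Finset.range x, (rudinShapiroBlock b t).coeff i * z ^ i

theorem rudinShapiroInit_two_pow (z : ℂ) (b : Bool) (t : ℕ) :
    rudinShapiroInit z b t (2 ^ t) = (rudinShapiroBlock b t).eval z := by
  rw [eval_eq_sum_range' (n := 2 ^ t)]
  · rfl
  · by_cases h0 : rudinShapiroBlock b t = 0
    · rw [h0]; simp
    · rw [natDegree_lt_iff_degree_lt h0, degree_lt_iff_coeff_zero]
      exact fun i hi => coeff_rudinShapiroBlock_of_le b hi

theorem rudinShapiroInit_succ_low (z : ℂ) (b : Bool) {t x : ℕ} (hx : x ≤ 2 ^ t) :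
    rudinShapiroInit z b (t + 1) x = rudinShapiroInit z false t x :=
  Finset.sum_congr rfl fun i hi => by
    rw [coeff_rudinShapiroBlock_succ_low b ((Finset.mem_range.1 hi).trans_le hx)]

theorem rudinShapiroInit_succ_high (z : ℂ) (b : Bool) (t x : ℕ) :
    rudinShapiroInit z b (t + 1) (2 ^ t + x) = (rudinShapiroBlock false t).eval z +
      (if b then -1 else 1) * z ^ 2 ^ t * rudinShapiroInit z true t x := by
  rw [← rudinShapiroInit_two_pow, ← rudinShapiroInit_succ_low z b le_rfl]
  unfold rudinShapiroInit
  rw [Finset.sum_range_add, Finset.mul_sum]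
  congr 1
  refine Finset.sum_congr rfl fun i _ => ?_
  rw [coeff_rudinShapiroBlock_succ_high, pow_add]
  ring

theorem norm_rudinShapiroInit_sub_le {z : ℂ} (hz : ‖z‖ = 1) (b : Bool) (t : ℕ) {m n : ℕ}
    (h : m ≤ n) : ‖rudinShapiroInit z b t n - rudinShapiroInit z b t m‖ ≤ (n : ℝ) - m := by
  unfold rudinShapiroInit
  rw [← Finset.sum_Ico_eq_sub _ h, ← Nat.cast_sub h, ← Nat.card_Ico, ← nsmul_one]
  refine norm_sum_le_of_le _ (fun i _ => ?_) |>.trans_eq (Finset.sum_const _)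
  rw [norm_mul, norm_pow, hz, one_pow, mul_one]
  exact norm_coeff_rudinShapiroBlock_le b t i

/-- The splitting of the Rudin–Shapiro polynomials at a point of the unit circle. -/
noncomputable def rudinShapiroSystem {z : ℂ} (hz : ‖z‖ = 1) : GolaySystem where
  v b t := (rudinShapiroBlock b t).eval z
  R := rudinShapiroInit z
  L b t y := (rudinShapiroBlock b t).eval z - rudinShapiroInit z b t (2 ^ t - y)
  w t := z ^ 2 ^ t
  c _ := 1
  d _ := 1
  norm_w t := by simp [hz]
  norm_c t := by simp
  norm_d t := by simp
  norm_v_zero b := by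
    cases b <;> simp [rudinShapiroBlock, rudinShapiroP, rudinShapiroQ, rudinShapiroPair]
  v_false_succ t := by simp [rudinShapiroBlock, rudinShapiroP_succ]
  v_true_succ t := by simp [rudinShapiroBlock, rudinShapiroQ_succ]
  R_false_low t x h := by rw [rudinShapiroInit_succ_low z _ h, one_mul]
  R_true_low t x h := by rw [rudinShapiroInit_succ_low z _ h, one_mul]
  R_false_high t x _ := by rw [rudinShapiroInit_succ_high]; simp
  R_true_high t x _ := by rw [rudinShapiroInit_succ_high]; simp; ring
  L_false_low t y h := by
    rw [show 2 ^ (t + 1) - y = 2 ^ t + (2 ^ t - y) by rw [pow_succ]; omega,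
      rudinShapiroInit_succ_high]
    simp [rudinShapiroBlock, rudinShapiroP_succ]; ring
  L_true_low t y h := by
    rw [show 2 ^ (t + 1) - y = 2 ^ t + (2 ^ t - y) by rw [pow_succ]; omega,
      rudinShapiroInit_succ_high]
    simp [rudinShapiroBlock, rudinShapiroQ_succ]; ring
  L_false_high t y h := by
    rw [show 2 ^ (t + 1) - (2 ^ t + y) = 2 ^ t - y by rw [pow_succ]; omega,
      rudinShapiroInit_succ_low z _ (Nat.sub_le _ _)]
    simp [rudinShapiroBlock, rudinShapiroP_succ]; ring
  L_true_high t y h := by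
    rw [show 2 ^ (t + 1) - (2 ^ t + y) = 2 ^ t - y by rw [pow_succ]; omega,
      rudinShapiroInit_succ_low z _ (Nat.sub_le _ _)]
    simp [rudinShapiroBlock, rudinShapiroQ_succ]; ring
  R_add_L b t x y h := by rw [show 2 ^ t - y = x by omega]; ring
  norm_R_le b t x _ := by
    simpa [rudinShapiroInit] using norm_rudinShapiroInit_sub_le hz b t (Nat.zero_le x)
  norm_L_le b t y h := by
    rw [← rudinShapiroInit_two_pow]
    refine (norm_rudinShapiroInit_sub_le hz b t (Nat.sub_le _ _)).trans (le_of_eq ?_)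
    rw [Nat.cast_sub h]; ring

theorem eval_rudinShapiroLT {n t : ℕ} (h : n ≤ 2 ^ t) (z : ℂ) :
    (rudinShapiroLT n).eval z = rudinShapiroInit z false t n := by
  rw [rudinShapiroLT, eval_finsetSum, rudinShapiroInit]
  refine Finset.sum_congr rfl fun i hi => ?_
  rw [eval_mul, eval_C, eval_pow, eval_X,
    rudinShapiroCoeff_eq ((Finset.mem_range.1 hi).trans_le h)]
  simp [rudinShapiroBlock]

theorem theorem2 (m n : ℕ) (hmn : m ≤ n) (z : ℂ) (hz : ‖z‖ = 1) :
    ‖(rudinShapiroIco m n).eval z‖ ≤ Real.sqrt (10 * ((n : ℝ) - (m : ℝ))) := by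
  -- Any level whose block contains the first `n` terms would do; level `n` is a convenient choice.
  have hn : n ≤ 2 ^ n := Nat.lt_two_pow_self.le
  rw [rudinShapiroIco, eval_sub, eval_rudinShapiroLT hn, eval_rudinShapiroLT (hmn.trans hn)]
  exact (rudinShapiroSystem hz).norm_R_sub_R_le false n hmn hn
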